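/- Let $G=(V,E)$ be a finite simple graph that is $3$-connected, i.e. $|V|\ge 4$ and any two distinct nodes are joined by three distinct, pairwise internally node-disjoint paths. For $S\subseteq V$ let $\delta(S)=\{e\in E : |e\cap S|=1\}$; it is a bond if both $G[S]$ and $G-S$ are connected (the graph without nodes counts as connected). Let $\mathrm{Bond}(G)\subseteq\mathbb{R}^E$ be the convex hull of the indicator vectors $x^\delta$ of all bonds $\delta$ of $G$. A cycle $C$ of $G$ is interleaved if there are distinct nodes $v_1,v_2,v_3,v_4\in V(C)$, not necessarily neighboring, occurring along $C$ in this order, and two node-disjoint paths in $G-E(C)$, one from $v_1$ to $v_3$ and one from $v_2$ to $v_4$; otherwise $C$ is non-interleaved. If $C$ is a non-interleaved cycle of $G$, then the inequality $\sum_{e\in E(C)} x_e\le 2$ defines a facet of $\mathrm{Bond}(G)$: it holds for all $x\in\mathrm{Bond}(G)$, and the set $\mathrm{Bond}(G)\cap\{x : \sum_{e\in E(C)}x_e=2\}$ is nonempty and has dimension $\dim \mathrm{Bond}(G)-1$. -/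

import Mathlib

noncomputable section

namespace BondPolytope

/-! ### Inequalities, faces and facets in `ℝ^ι` -/

section Polyhedral

variable {ι : Type*} [Fintype ι]

/-- The linear inequality `aᵀ x ≤ b` is valid for `P`. -/
def IsValid (P : Set (ι → ℝ)) (a : ι → ℝ) (b : ℝ) : Prop :=
  ∀ x ∈ P, a ⬝ᵥ x ≤ b

/-- The set `P ∩ {aᵀ x = b}`. -/
def face (P : Set (ι → ℝ)) (a : ι → ℝ) (b : ℝ) : Set (ι → ℝ) :=
  {x ∈ P | a ⬝ᵥ x = b}

/-- The dimension of the affine hull of a (nonempty) set. -/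
def dim (P : Set (ι → ℝ)) : ℕ :=
  Module.finrank ℝ (affineSpan ℝ P).direction

/-- The inequality `aᵀ x ≤ b` defines a facet of `P`: it is valid for `P`, its normal vector is
nonzero, it is tight, and the face that it defines has dimension `dim P - 1`. -/
structure IsFacetDefining (P : Set (ι → ℝ)) (a : ι → ℝ) (b : ℝ) : Prop where
  valid : IsValid P a b
  normal_ne_zero : a ≠ 0
  tight : (face P a b).Nonempty
  dim_face : dim (face P a b) + 1 = dim P

end Polyhedral

/-! ### Connectivity, cuts, bonds and cycles -/

section Graph

variable {V : Type*} (G : SimpleGraph V)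

/-- `G` is `k`-connected: it has at least `k + 1` nodes, and any two distinct nodes are joined by
`k` (distinct) paths that pairwise share no node except the two ends. -/
def IsKConnected (k : ℕ) : Prop :=
  k + 1 ≤ Nat.card V ∧
    ∀ v w : V, v ≠ w → ∃ P : Fin k → G.Path v w, Function.Injective P ∧
      ∀ i j : Fin k, i ≠ j → ∀ u : V,
        u ∈ (P i : G.Walk v w).support → u ∈ (P j : G.Walk v w).support → u = v ∨ u = w

/-- The cut `δ(S)`: all edges of `G` with exactly one end in `S`. -/
def cut (S : Set V) : Set (Sym2 V) :=
  {e ∈ G.edgeSet | ∃ u ∈ S, ∃ v ∉ S, e = s(u, v)}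

/-- A bond is a cut `δ(S)` such that `G[S]` and `G - S` are connected; here the graph without nodes
counts as connected, so that `∅ = δ(∅)` is a bond if `G` is connected. -/
def IsBond (δ : Set (Sym2 V)) : Prop :=
  ∃ S : Set V, (G.induce S).Preconnected ∧ (G.induce Sᶜ).Preconnected ∧ δ = cut G S

/-- The indicator vector in `ℝ^E` of a set of edges. -/
def edgeVector (δ : Set (Sym2 V)) : G.edgeSet → ℝ :=
  {e : G.edgeSet | (e : Sym2 V) ∈ δ}.indicator 1

/-- `Bond(G)`, the convex hull of the indicator vectors of all bonds of `G`. -/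
def bondPolytope : Set (G.edgeSet → ℝ) :=
  convexHull ℝ {x | ∃ δ : Set (Sym2 V), IsBond G δ ∧ x = edgeVector G δ}

variable {G}

/-- The cycle `c` is interleaved: there are nodes `v₁, v₂, v₃, v₄` that occur along `c` in this
order and node-disjoint paths in `G - E(c)` from `v₁` to `v₃` and from `v₂` to `v₄`. -/
def IsInterleaved {v : V} (c : G.Walk v v) : Prop :=
  ∃ i₁ i₂ i₃ i₄ : ℕ, i₁ < i₂ ∧ i₂ < i₃ ∧ i₃ < i₄ ∧ i₄ < c.length ∧
    ∃ (P : (G.deleteEdges c.edgeSet).Path (c.getVert i₁) (c.getVert i₃))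
      (Q : (G.deleteEdges c.edgeSet).Path (c.getVert i₂) (c.getVert i₄)),
      ∀ u : V, u ∈ P.1.support → u ∉ Q.1.support

open Classical in
/-- The left-hand side `∑_{e ∈ E(c)} x_e` is the linear form with normal vector
`edgeVector G E(c)`. -/
theorem edgeVector_dotProduct [Fintype G.edgeSet] {v : V} (c : G.Walk v v) (x : G.edgeSet → ℝ) :
    edgeVector G c.edgeSet ⬝ᵥ x = ∑ e : G.edgeSet, if (e : Sym2 V) ∈ c.edges then x e else 0 := by
  simp [edgeVector, dotProduct, Set.indicator_apply, SimpleGraph.Walk.mem_edgeSet]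

end Graph

end BondPolytope

end

/-!
The inequality is valid because a bond `δ(A)` that met the cycle `c` more than twice would put four
nodes of `c` alternately into the connected sets `A` and `Aᶜ`. Edges of `c` inside a connected set
that avoids two nodes of `c` never leave one of the two arcs between these nodes, so such a set
contains a path outside `E(c)` from one arc to the other (`exists_walk_between_arcs`). Applied to
`A` and then to `Aᶜ`, this yields disjoint crossing paths (`isInterleaved_of_alternating`). Hence
every bond whose two sides both meet `c` lies on the face (`changes_eq_two`).

For the dimension, since the empty bond is not on the face, it suffices that a vector `y` with a
constant value `β` on these bonds is a multiple of the indicator vector of `c`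
(`isFacetDefining_of_forall_eq_smul`, `ConstOnBonds.eq_smul`).

* For an edge `ab` of `c`, the sum of the weights of `δ({a})` and `δ({b})` exceeds the weight of
  `δ({a, b})` by `2 y_{ab}`. All three weights are `β`, because deleting two nodes leaves a
  3-connected graph connected, so `y_{ab} = β / 2`.
* Let the nodes be partitioned into four connected sets `S`, `A`, `B`, `D`, where `S` avoids `c` and
  is adjacent to the other three, which meet `c`. Comparing the bonds of `A`, `B`, `D` with those of
  their unions with `S` gives `y(S, A) = y(S, B) + y(S, D)` and its rotations, so all three weights
  vanish (`IsCyclePartition.weight_eq_zero`). That these cuts are bonds uses that `A`, `B`, `D` are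
  pairwise adjacent, which follows from counting the edges of `c` between them.
* Such partitions are supplied by Menger's theorem, obtained here from Hall's theorem
  (`exists_disjoint_setConn_of_separators`), and by letting the resulting disjoint sets grow
  (`SetConn.exists_partition_extending`). With `S` equal to `{a}`, `{b}` and `{a, b}` they give
  `y_{ab} = 0` if neither end of the edge `ab` is on `c`; with `S = {a}` and `{b}` as one of the
  other sets they give `y_{ab} = 0` if only `b` is on `c`. An edge outside `E(c)` with both ends on
  `c` does not exist, since `G - {a, b}` contains a path crossing it (`mem_edges_of_adj`).
-/

namespace BondPolytope

open SimpleGraph Finset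

variable {V : Type*} {G : SimpleGraph V}

/-! ### Connected sets of nodes -/

/-- `R` induces a connected subgraph of `G` (or is empty), expressed by closure: a set that meets
`R` and is closed under stepping along the edges of `G[R]` contains `R`. -/
def SetConn (G : SimpleGraph V) (R : Set V) : Prop :=
  ∀ T : Set V, (T ∩ R).Nonempty → (∀ a ∈ T ∩ R, ∀ b ∈ R, G.Adj a b → b ∈ T) → R ⊆ T

theorem setConn_iff_preconnected {R : Set V} : SetConn G R ↔ (G.induce R).Preconnected := by
  constructor
  · intro h x y
    obtain ⟨_, hr⟩ := h {b | ∃ h : b ∈ R, (G.induce R).Reachable x ⟨b, h⟩}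
      ⟨x, ⟨x.2, Reachable.refl _⟩, x.2⟩
      (fun a ha b hb hab => ⟨hb, ha.1.2.trans
        (Adj.reachable (G := G.induce R) (u := ⟨a, ha.2⟩) (v := ⟨b, hb⟩) hab)⟩) y.2
    exact hr
  · rintro h T ⟨x, hxT, hxR⟩ hT y hy
    obtain ⟨p⟩ := h ⟨x, hxR⟩ ⟨y, hy⟩
    have key : ∀ (a b : R) (_ : (G.induce R).Walk a b), (a : V) ∈ T → (b : V) ∈ T := by
      intro a b p
      induction p with
      | nil => exact id
      | @cons u v w huv _ ih => exact fun hu => ih (hT u ⟨hu, u.2⟩ v v.2 huv)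
    exact key _ _ p hxT

theorem setConn_empty : SetConn G ∅ := fun _ _ _ => Set.empty_subset _

theorem setConn_singleton (a : V) : SetConn G {a} := by
  rintro T ⟨x, hxT, rfl⟩ _ y rfl
  exact hxT

theorem SetConn.union {A B : Set V} (hA : SetConn G A) (hB : SetConn G B)
    (h : ∃ a ∈ A, ∃ b ∈ B, G.Adj a b) : SetConn G (A ∪ B) := by
  obtain ⟨a, ha, b, hb, hab⟩ := h
  intro T hT hcl
  have hA' : (T ∩ A).Nonempty → A ⊆ T := fun hne => hA T hne
    fun x hx y hy hxy => hcl x ⟨hx.1, Or.inl hx.2⟩ y (Or.inl hy) hxy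
  have hB' : (T ∩ B).Nonempty → B ⊆ T := fun hne => hB T hne
    fun x hx y hy hxy => hcl x ⟨hx.1, Or.inr hx.2⟩ y (Or.inr hy) hxy
  obtain ⟨x, hxT, hx | hx⟩ := hT
  · have hAT := hA' ⟨x, hxT, hx⟩
    exact Set.union_subset hAT
      (hB' ⟨b, hcl a ⟨hAT ha, Or.inl ha⟩ b (Or.inr hb) hab, hb⟩)
  · have hBT := hB' ⟨x, hxT, hx⟩
    exact Set.union_subset
      (hA' ⟨a, hcl b ⟨hBT hb, Or.inr hb⟩ a (Or.inl ha) hab.symm, ha⟩) hBT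

/-- Disjoint connected subsets of a connected set can be enlarged to a partition of it into
connected sets. -/
theorem SetConn.exists_partition_extending [Finite V] {ι : Type*} [Nonempty ι] {R : Set V}
    (hR : SetConn G R) (W : ι → Set V) (hsub : ∀ i, W i ⊆ R) (hconn : ∀ i, SetConn G (W i))
    (hne : ∀ i, (W i).Nonempty) (hdisj : ∀ i j, i ≠ j → Disjoint (W i) (W j)) :
    ∃ W' : ι → Set V, (∀ i, W i ⊆ W' i) ∧ (∀ i, SetConn G (W' i)) ∧
      (∀ i j, i ≠ j → Disjoint (W' i) (W' j)) ∧ ⋃ i, W' i = R := by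
  classical
  induction hn : (R \ ⋃ i, W i).ncard using Nat.strong_induction_on generalizing W with
  | _ n ih =>
  by_cases hcov : R ⊆ ⋃ i, W i
  · exact ⟨W, fun i => le_rfl, hconn, hdisj, (Set.iUnion_subset hsub).antisymm hcov⟩
  -- An edge of `G[R]` leaves the covered part; its outer end joins the set of its inner end.
  obtain ⟨a, ha, b, hbR, hab, hb⟩ : ∃ a ∈ ⋃ i, W i, ∃ b ∈ R, G.Adj a b ∧ b ∉ ⋃ i, W i := by
    by_contra! hcon
    obtain ⟨x, hx⟩ := hne (Classical.arbitrary ι)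
    exact hcov (hR _ ⟨x, Set.mem_iUnion_of_mem _ hx, hsub _ hx⟩
      fun a ha b hb hab => hcon a ha.1 b hb hab)
  obtain ⟨i, hai⟩ := Set.mem_iUnion.1 ha
  have hbW : ∀ j, b ∉ W j := fun j hj => hb (Set.mem_iUnion_of_mem j hj)
  let W₁ : ι → Set V := Function.update W i (W i ∪ {b})
  have h1 : W₁ i = W i ∪ {b} := Function.update_self ..
  have h2 : ∀ j, j ≠ i → W₁ j = W j := fun j hj => Function.update_of_ne hj ..
  have hle : ∀ j, W j ⊆ W₁ j := by
    intro j
    by_cases hj : j = i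
    · subst hj; rw [h1]; exact Set.subset_union_left
    · rw [h2 j hj]
  have hdis : ∀ j, j ≠ i → Disjoint (W i ∪ {b}) (W j) := fun j hj => by
    rw [Set.disjoint_union_left]
    exact ⟨hdisj _ _ (Ne.symm hj), Set.disjoint_singleton_left.2 (hbW j)⟩
  obtain ⟨W', g1, g2, g3, g4⟩ := ih ((R \ ⋃ i, W₁ i).ncard) (by
      rw [← hn]
      refine Set.ncard_lt_ncard ⟨Set.sdiff_subset_sdiff_right (Set.iUnion_mono hle), fun h => ?_⟩
        (Set.toFinite _)
      refine (h ⟨hbR, hb⟩).2 (Set.mem_iUnion_of_mem i ?_)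
      rw [h1]; exact Or.inr rfl) W₁
    (fun j => by
      by_cases hj : j = i
      · subst hj; rw [h1]; exact Set.union_subset (hsub j) (Set.singleton_subset_iff.2 hbR)
      · rw [h2 j hj]; exact hsub j)
    (fun j => by
      by_cases hj : j = i
      · subst hj; rw [h1]
        exact (hconn j).union (setConn_singleton b) ⟨a, hai, b, rfl, hab⟩
      · rw [h2 j hj]; exact hconn j)
    (fun j => (hne j).mono (hle j))
    (fun j l hjl => by
      by_cases hj : j = i
      · subst hj; rw [h1, h2 l hjl.symm]; exact hdis l hjl.symm
      · by_cases hl : l = i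
        · subst hl; rw [h1, h2 j hjl]; exact (hdis j hjl).symm
        · rw [h2 j hj, h2 l hl]; exact hdisj j l hjl) rfl
  exact ⟨W', fun j => (hle j).trans (g1 j), g2, g3, g4⟩

/-- Menger's theorem for connected sets: if fewer than `k` nodes never suffice to separate `N`
from `C` in `G[R]`, then `G[R]` has `k` disjoint connected sets that each meet `N` and `C`.
Separators are described by the set `U` of nodes on the side of `N`. -/
theorem exists_disjoint_setConn_of_separators [Finite V] {R N C : Set V} {k : ℕ} (hNR : N ⊆ R)
    (hsep : ∀ U Z : Finset V, (∀ x ∈ U, x ∈ R ∧ x ∉ C) → (∀ x ∈ N, x ∉ U → x ∈ Z) →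
      (∀ a ∈ U, ∀ b ∈ R, G.Adj a b → b ∉ U → b ∈ Z) → k ≤ Z.card) :
    ∃ W : Fin k → Set V, (∀ i, W i ⊆ R) ∧ (∀ i, SetConn G (W i)) ∧
      (∀ i, (W i ∩ N).Nonempty) ∧ (∀ i, (W i ∩ C).Nonempty) ∧
      ∀ i j, i ≠ j → Disjoint (W i) (W j) := by
  classical
  have := Fintype.ofFinite V
  let L := {x : V // x ∈ R ∧ x ∉ C}
  -- The successor of a node on its path is chosen by Hall's theorem: every node of `R \ C` gets
  -- itself (if it is on no path) or a neighbour, and each of `k` extra sources gets a node of `N`.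
  let t : Fin k ⊕ L → Finset V := Sum.elim (fun _ => univ.filter (· ∈ N))
    (fun x => univ.filter fun y => y = x.1 ∨ y ∈ R ∧ G.Adj x.1 y)
  obtain ⟨φ, hφ, hφt⟩ := (Finset.all_card_le_biUnion_card_iff_exists_injective t).1 (by
    intro s
    let U : Finset V := s.toRight.map (Function.Embedding.subtype _)
    have hU : ∀ x, x ∈ U ↔ ∃ h : x ∈ R ∧ x ∉ C, Sum.inr ⟨x, h⟩ ∈ s := by
      intro x; simp [U, L]
    have hUcard : U.card = s.toRight.card := Finset.card_map _
    have hUsub : U ⊆ s.biUnion t := by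
      intro x hx
      obtain ⟨h, hs⟩ := (hU x).1 hx
      exact Finset.mem_biUnion.2 ⟨_, hs, by simp [t]⟩
    have hcard := Finset.card_toLeft_add_card_toRight (u := s)
    rcases s.toLeft.eq_empty_or_nonempty with h0 | ⟨i, hi⟩
    · rw [h0, Finset.card_empty] at hcard
      have := Finset.card_le_card hUsub
      omega
    · have hk := hsep U (s.biUnion t \ U) (fun x hx => ((hU x).1 hx).1)
        (fun x hx hxU => Finset.mem_sdiff.2 ⟨Finset.mem_biUnion.2
          ⟨_, Finset.mem_toLeft.1 hi, by simpa [t] using hx⟩, hxU⟩)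
        (fun a ha b hb hab hbU => by
          obtain ⟨h, hs⟩ := (hU a).1 ha
          exact Finset.mem_sdiff.2 ⟨Finset.mem_biUnion.2 ⟨_, hs, by simp [t, hb, hab]⟩, hbU⟩)
      have h1 := Finset.card_sdiff_add_card_eq_card hUsub
      have h2 : s.toLeft.card ≤ k := by simpa using Finset.card_le_univ s.toLeft
      omega)
  have hφN : ∀ i, φ (Sum.inl i) ∈ N := fun i => by simpa [t] using hφt (Sum.inl i)
  have hφR : ∀ x : L, φ (Sum.inr x) = x ∨ φ (Sum.inr x) ∈ R ∧ G.Adj x (φ (Sum.inr x)) :=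
    fun x => by simpa [t] using hφt (Sum.inr x)
  -- The `i`-th set is the orbit of the `i`-th source.
  let r : V → V → Prop := fun x y => ∃ h : x ∈ R ∧ x ∉ C, φ (Sum.inr ⟨x, h⟩) = y
  let W : Fin k → Set V := fun i => {x | Relation.ReflTransGen r (φ (Sum.inl i)) x}
  have hW0 : ∀ i, φ (Sum.inl i) ∈ W i := fun i => Relation.ReflTransGen.refl
  have hrR : ∀ x y, r x y → y ∈ R ∧ (y = x ∨ G.Adj x y) := by
    rintro x y ⟨h, rfl⟩
    rcases hφR ⟨x, h⟩ with h' | h'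
    · rw [h']; exact ⟨h.1, Or.inl rfl⟩
    · exact ⟨h'.1, Or.inr h'.2⟩
  have hWR : ∀ i, W i ⊆ R := by
    intro i x hx
    rcases Relation.ReflTransGen.cases_tail hx with h | ⟨y, _, hyx⟩
    · rw [h]; exact hNR (hφN i)
    · exact (hrR _ _ hyx).1
  refine ⟨W, hWR, fun i T hT hcl => ?_, fun i => ⟨_, hW0 i, hφN i⟩, fun i => ?_, ?_⟩
  · have key : ∀ x, x ∈ W i → (x ∈ T ↔ φ (Sum.inl i) ∈ T) := by
      intro x hx
      induction hx with
      | refl => rfl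
      | @tail y z hy hyz ih =>
        have hz : z ∈ W i := Relation.ReflTransGen.tail hy hyz
        rcases (hrR _ _ hyz).2 with rfl | hadj
        · exact ih
        · rw [← ih]
          exact ⟨fun h => hcl z ⟨h, hz⟩ y hy hadj.symm, fun h => hcl y ⟨h, hy⟩ z hz hadj⟩
    obtain ⟨x, hxT, hx⟩ := hT
    exact fun y hy => (key y hy).2 ((key x hx).1 hxT)
  · -- An orbit missing `C` would be mapped injectively into itself without its source.
    by_contra hne
    have hWL : ∀ x ∈ W i, x ∈ R ∧ x ∉ C := fun x hx => ⟨hWR i hx, fun hC => hne ⟨x, hx, hC⟩⟩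
    let F : Finset V := {x | x ∈ W i}
    let g : V → V := fun x => if h : x ∈ R ∧ x ∉ C then φ (Sum.inr ⟨x, h⟩) else x
    have hg : ∀ x (hx : x ∈ W i), g x = φ (Sum.inr ⟨x, hWL x hx⟩) := fun x hx => dif_pos _
    have hF : ∀ x, x ∈ F ↔ x ∈ W i := by simp [F]
    have := Finset.card_le_card_of_injOn (s := F) (t := F.erase (φ (Sum.inl i))) g
      (fun x hx => by
        have hx' := (hF x).1 hx
        simp only [Finset.coe_erase, Set.mem_sdiff, Finset.mem_coe, Set.mem_singleton_iff]
        rw [hF, hg x hx']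
        exact ⟨Relation.ReflTransGen.tail hx' ⟨hWL x hx', rfl⟩,
          fun h => Sum.inr_ne_inl (hφ h)⟩)
      (fun x hx y hy hxy => by
        have hx' := (hF x).1 hx
        have hy' := (hF y).1 hy
        rw [hg x hx', hg y hy'] at hxy
        exact congrArg Subtype.val (Sum.inr.inj (hφ hxy)))
    have h2 := Finset.card_erase_lt_of_mem ((hF _).2 (hW0 i))
    omega
  · intro i j hij
    rw [Set.disjoint_left]
    intro x hx hxj
    apply hij
    clear hij
    induction hx with
    | refl =>
      rcases Relation.ReflTransGen.cases_tail hxj with h | ⟨y, _, h, hy⟩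
      · simpa using hφ h
      · exact absurd (hφ hy) Sum.inr_ne_inl
    | @tail y z hy hyz ih =>
      obtain ⟨h, rfl⟩ := hyz
      rcases Relation.ReflTransGen.cases_tail hxj with h' | ⟨y', hy', h', hyy⟩
      · exact absurd (hφ h') Sum.inr_ne_inl
      · have : y' = y := congrArg Subtype.val (Sum.inr.inj (hφ hyy))
        exact ih (this ▸ hy')

/-! ### Changes of a predicate along a sequence -/

open Classical in
/-- The number of `k < n` such that exactly one of `p k` and `p (k + 1)` holds. -/
noncomputable def changes (p : ℕ → Prop) (n : ℕ) : ℕ :=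
  #{k ∈ range n | ¬(p k ↔ p (k + 1))}

theorem changes_zero (p : ℕ → Prop) : changes p 0 = 0 := by simp [changes]

open Classical in
theorem changes_succ (p : ℕ → Prop) (n : ℕ) :
    changes p (n + 1) = changes p n + if (p n ↔ p (n + 1)) then 0 else 1 := by
  unfold changes
  rw [Finset.range_add_one, Finset.filter_insert]
  split_ifs <;> simp_all

theorem odd_changes_iff (p : ℕ → Prop) (n : ℕ) : Odd (changes p n) ↔ ¬(p 0 ↔ p n) := by
  classical
  induction n with
  | zero => simp [changes_zero]
  | succ n ih =>
    rw [changes_succ]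
    split_ifs with h
    · rw [add_zero, ih, h]
    · rw [Nat.odd_add_one, ih]; tauto

theorem exists_alternating_of_one_le_changes {p : ℕ → Prop} {n : ℕ} (h : 1 ≤ changes p n) :
    ∃ i < n, ¬(p i ↔ p n) := by
  classical
  induction n with
  | zero => simp [changes_zero] at h
  | succ n ih =>
    rw [changes_succ] at h
    split_ifs at h with hn
    · obtain ⟨i, hi, h'⟩ := ih h
      exact ⟨i, hi.trans n.lt_succ_self, by tauto⟩
    · exact ⟨n, n.lt_succ_self, hn⟩

theorem exists_alternating_of_two_le_changes {p : ℕ → Prop} {n : ℕ} (h : 2 ≤ changes p n) :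
    ∃ i j, i < j ∧ j < n ∧ ¬(p i ↔ p j) ∧ ¬(p j ↔ p n) := by
  classical
  induction n with
  | zero => simp [changes_zero] at h
  | succ n ih =>
    rw [changes_succ] at h
    split_ifs at h with hn
    · obtain ⟨i, j, hij, hj, h1, h2⟩ := ih h
      exact ⟨i, j, hij, hj.trans n.lt_succ_self, h1, by tauto⟩
    · obtain ⟨i, hi, h1⟩ := exists_alternating_of_one_le_changes (Nat.le_of_succ_le_succ h)
      exact ⟨i, n, hi, n.lt_succ_self, h1, hn⟩

theorem exists_alternating_of_three_le_changes {p : ℕ → Prop} {n : ℕ} (h : 3 ≤ changes p n) :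
    ∃ i j k, i < j ∧ j < k ∧ k < n ∧ ¬(p i ↔ p j) ∧ ¬(p j ↔ p k) ∧ ¬(p k ↔ p n) := by
  classical
  induction n with
  | zero => simp [changes_zero] at h
  | succ n ih =>
    rw [changes_succ] at h
    split_ifs at h with hn
    · obtain ⟨i, j, k, hij, hjk, hk, h1, h2, h3⟩ := ih h
      exact ⟨i, j, k, hij, hjk, hk.trans n.lt_succ_self, h1, h2, by tauto⟩
    · obtain ⟨i, j, hi, hj, h1, h2⟩ :=
        exists_alternating_of_two_le_changes (Nat.le_of_succ_le_succ h)
      exact ⟨i, j, n, hi, hj, n.lt_succ_self, h1, h2, hn⟩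

/-- A closed sequence that changes more than twice takes alternating values at four positions of
one period. -/
theorem exists_alternating_of_two_lt_changes {p : ℕ → Prop} {n : ℕ} (hp : p 0 ↔ p n)
    (h : 2 < changes p n) :
    ∃ i j k l, i < j ∧ j < k ∧ k < l ∧ l < n ∧ ¬(p i ↔ p j) ∧ ¬(p j ↔ p k) ∧ ¬(p k ↔ p l) := by
  classical
  have hodd := odd_changes_iff p n
  -- By parity there are at least four changes, so three of them occur before position `n - 1`.
  have h4 : 4 ≤ changes p n := by
    by_contra h4
    exact hodd.1 (by rw [show changes p n = 3 by omega]; decide) hp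
  obtain _ | n := n
  · simp [changes_zero] at h
  · rw [changes_succ] at h4
    obtain ⟨i, j, k, hij, hjk, hk, h1, h2, h3⟩ :=
      exists_alternating_of_three_le_changes (p := p) (n := n) (by split_ifs at h4 <;> omega)
    exact ⟨i, j, k, n, hij, hjk, hk, n.lt_succ_self, h1, h2, h3⟩

/-! ### Cuts and a non-interleaved cycle -/

theorem exists_getVert_eq_of_mem_support {v x : V} {c : G.Walk v v} (hc : c.IsCycle)
    (hx : x ∈ c.support) : ∃ i < c.length, c.getVert i = x := by
  obtain ⟨n, rfl, hn⟩ := Walk.mem_support_iff_exists_getVert.1 hx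
  have h3 := hc.three_le_length
  rcases hn.lt_or_eq with h | rfl
  · exact ⟨n, h, rfl⟩
  · exact ⟨0, by omega, by simp⟩

theorem eq_of_getVert_eq {v : V} {c : G.Walk v v} (hc : c.IsCycle) {i j : ℕ} (hi : i < c.length)
    (hj : j < c.length) (h : c.getVert i = c.getVert j) : i = j :=
  hc.getVert_injOn' (by simp only [Set.mem_ofPred_eq]; omega)
    (by simp only [Set.mem_ofPred_eq]; omega) h

/-- Two nodes joined by an edge of a cycle occur at cyclically consecutive positions. -/
theorem exists_positions_of_mem_edges {v x y : V} {c : G.Walk v v} (hc : c.IsCycle)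
    (h : s(x, y) ∈ c.edges) :
    ∃ i j, i < c.length ∧ j < c.length ∧ c.getVert i = x ∧ c.getVert j = y ∧
      (j = i + 1 ∨ i = j + 1 ∨ (i = 0 ∧ j + 1 = c.length) ∨ (j = 0 ∧ i + 1 = c.length)) := by
  obtain ⟨k, hk, hke⟩ := (Walk.mk_mem_edges_iff_exists c).1 h
  have h3 := hc.three_le_length
  obtain ⟨l, hl, hlv, hkl⟩ : ∃ l < c.length, c.getVert l = c.getVert (k + 1) ∧
      (l = k + 1 ∨ l = 0 ∧ k + 1 = c.length) := by
    rcases Nat.lt_or_ge (k + 1) c.length with h | h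
    · exact ⟨k + 1, h, rfl, Or.inl rfl⟩
    · have : k + 1 = c.length := by omega
      exact ⟨0, by omega, by rw [this]; simp, Or.inr ⟨rfl, this⟩⟩
  rw [← hlv] at hke
  rcases Sym2.eq_iff.1 hke with ⟨h1, h2⟩ | ⟨h1, h2⟩
  · exact ⟨k, l, hk, hl, h1, h2, by omega⟩
  · exact ⟨l, k, hl, hk, h2, h1, by omega⟩

/-- If `R` is connected, avoids two nodes of the cycle `c`, and meets both arcs between them, then
`R` contains a path outside `E(c)` from one arc to the other: the edges of `c` in `R` do not leave
their arc. -/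
theorem exists_walk_between_arcs {v : V} {c : G.Walk v v} (hc : c.IsCycle) {R : Set V}
    (hR : SetConn G R) {a b : ℕ} (hb : b < c.length)
    (haR : c.getVert a ∉ R) (hbR : c.getVert b ∉ R) {s₀ t₀ : ℕ}
    (hs₀ : a < s₀ ∧ s₀ < b) (hs₀R : c.getVert s₀ ∈ R)
    (ht₀ : t₀ < c.length) (ht₀' : t₀ < a ∨ b < t₀) (ht₀R : c.getVert t₀ ∈ R) :
    ∃ s t, (a < s ∧ s < b) ∧ t < c.length ∧ (t < a ∨ b < t) ∧
      ∃ p : (G.deleteEdges c.edgeSet).Walk (c.getVert s) (c.getVert t),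
        ∀ u ∈ p.support, u ∈ R := by
  by_contra! hcon
  let T : Set V := {y | ∃ s, (a < s ∧ s < b) ∧
    ∃ p : (G.deleteEdges c.edgeSet).Walk (c.getVert s) y, ∀ u ∈ p.support, u ∈ R}
  have hT : R ⊆ T := by
    refine hR T ⟨c.getVert s₀, ⟨s₀, hs₀, Walk.nil, by simpa using hs₀R⟩, hs₀R⟩ ?_
    rintro x ⟨⟨s, hs, p, hp⟩, hxR⟩ y hy hxy
    by_cases hxe : s(x, y) ∈ c.edges
    · obtain ⟨i, j, hi, hj, rfl, rfl, hij⟩ := exists_positions_of_mem_edges hc hxe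
      have hia : i ≠ a := fun h => haR (h ▸ hxR)
      have hib : i ≠ b := fun h => hbR (h ▸ hxR)
      have hja : j ≠ a := fun h => haR (h ▸ hy)
      have hjb : j ≠ b := fun h => hbR (h ▸ hy)
      have hi' : ¬(i < a ∨ b < i) := fun h => by
        obtain ⟨u, hu, hu'⟩ := hcon s i hs hi h p
        exact hu' (hp u hu)
      exact ⟨j, by omega, Walk.nil, by simpa using hy⟩
    · refine ⟨s, hs, p.concat ?_, ?_⟩
      · rw [deleteEdges_adj]
        exact ⟨hxy, fun h => hxe (Walk.mem_edgeSet.1 h)⟩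
      · intro u hu
        have hu' : u ∈ p.support ∨ u = y := by simpa [Walk.support_concat] using hu
        rcases hu' with hu' | rfl
        · exact hp u hu'
        · exact hy
  obtain ⟨s, hs, p, hp⟩ := hT ht₀R
  obtain ⟨u, hu, hu'⟩ := hcon s t₀ hs ht₀ ht₀' p
  exact hu' (hp u hu)

theorem isInterleaved_of_disjoint_walks {v : V} {c : G.Walk v v} {A B : Set V}
    (hAB : Disjoint A B) {a b s t : ℕ} (hb : b < c.length) (hs : a < s ∧ s < b)
    (ht : t < c.length) (ht' : t < a ∨ b < t)
    (p : (G.deleteEdges c.edgeSet).Walk (c.getVert a) (c.getVert b)) (hp : ∀ u ∈ p.support, u ∈ A)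
    (q : (G.deleteEdges c.edgeSet).Walk (c.getVert s) (c.getVert t))
    (hq : ∀ u ∈ q.support, u ∈ B) : IsInterleaved c := by
  classical
  rcases ht' with h | h
  · refine ⟨t, a, s, b, h, hs.1, hs.2, hb, q.reverse.toPath, p.toPath, fun u hu hu' => ?_⟩
    have h1 := Walk.support_toPath_subset_support _ hu
    rw [Walk.support_reverse, List.mem_reverse] at h1
    exact Set.disjoint_left.1 hAB (hp u (Walk.support_toPath_subset_support _ hu')) (hq u h1)
  · refine ⟨a, s, b, t, hs.1, hs.2, h, ht, p.toPath, q.toPath, fun u hu hu' => ?_⟩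
    exact Set.disjoint_left.1 hAB (hp u (Walk.support_toPath_subset_support _ hu))
      (hq u (Walk.support_toPath_subset_support _ hu'))

/-- If the nodes of a cycle at four increasing positions alternate between a connected set and its
connected complement, then the cycle is interleaved. -/
theorem isInterleaved_of_alternating {v : V} {c : G.Walk v v} (hc : c.IsCycle) {A : Set V}
    (hA : SetConn G A) (hA' : SetConn G Aᶜ) {i j k l : ℕ} (hij : i < j) (hjk : j < k) (hkl : k < l)
    (hl : l < c.length) (hi : c.getVert i ∈ A) (hj : c.getVert j ∉ A) (hk : c.getVert k ∈ A)
    (hlA : c.getVert l ∉ A) : IsInterleaved c := by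
  obtain ⟨s, t, hs, ht, ht', p, hp⟩ := exists_walk_between_arcs hc hA hl hj hlA ⟨hjk, hkl⟩ hk
    (t₀ := i) (by omega) (by omega) hi
  have hsA : c.getVert s ∈ A := hp _ p.start_mem_support
  have htA : c.getVert t ∈ A := hp _ p.end_mem_support
  rcases ht' with h | h
  · obtain ⟨s', t', hs', ht1, ht2, q, hq⟩ := exists_walk_between_arcs hc hA' (a := t) (b := s)
      (s₀ := j) (t₀ := l) (by omega) (fun h => h htA) (fun h => h hsA) (by omega) hj hl (by omega)
      hlA
    exact isInterleaved_of_disjoint_walks disjoint_compl_right (by omega) hs' ht1 ht2 p.reverse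
      (fun u hu => hp u (by simpa using hu)) q hq
  · obtain ⟨s', t', hs', ht1, ht2, q, hq⟩ := exists_walk_between_arcs hc hA' (a := s) (b := t)
      (s₀ := l) (t₀ := j) (by omega) (fun h => h hsA) (fun h => h htA) (by omega) hlA
      (by omega) (by omega) hj
    exact isInterleaved_of_disjoint_walks disjoint_compl_right ht hs' ht1 ht2 p hp q hq

/-- A bond meets a non-interleaved cycle in at most two edges. -/
theorem changes_le_two {v : V} {c : G.Walk v v} (hc : c.IsCycle) (hni : ¬IsInterleaved c)
    {A : Set V} (hA : SetConn G A) (hA' : SetConn G Aᶜ) :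
    changes (fun k => c.getVert k ∈ A) c.length ≤ 2 := by
  by_contra! h
  obtain ⟨i, j, k, l, hij, hjk, hkl, hl, h1, h2, h3⟩ :=
    exists_alternating_of_two_lt_changes (by simp) h
  apply hni
  by_cases hi : c.getVert i ∈ A
  · exact isInterleaved_of_alternating hc hA hA' hij hjk hkl hl hi (by tauto) (by tauto) (by tauto)
  · exact isInterleaved_of_alternating hc hA' (by rwa [compl_compl]) hij hjk hkl hl hi
      (by simp only [Set.mem_compl_iff]; tauto) (by simp only [Set.mem_compl_iff]; tauto)
      (by simp only [Set.mem_compl_iff]; tauto)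

theorem changes_eq_two {v : V} {c : G.Walk v v} (hc : c.IsCycle) (hni : ¬IsInterleaved c)
    {A : Set V} (hA : SetConn G A) (hA' : SetConn G Aᶜ) (h1 : ∃ x ∈ A, x ∈ c.support)
    (h2 : ∃ x ∉ A, x ∈ c.support) : changes (fun k => c.getVert k ∈ A) c.length = 2 := by
  classical
  have hle := changes_le_two hc hni hA hA'
  have hodd := odd_changes_iff (fun k => c.getVert k ∈ A) c.length
  have hne : changes (fun k => c.getVert k ∈ A) c.length ≠ 0 := by
    intro h0
    have hall : ∀ k < c.length, (c.getVert k ∈ A ↔ c.getVert (k + 1) ∈ A) := by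
      simpa [changes, Finset.filter_eq_empty_iff] using h0
    have hconst : ∀ k ≤ c.length, (c.getVert k ∈ A ↔ c.getVert 0 ∈ A) := by
      intro k hk
      induction k with
      | zero => rfl
      | succ k ih => rw [← hall k (by omega), ih (by omega)]
    obtain ⟨x, hx, hxc⟩ := h1
    obtain ⟨y, hy, hyc⟩ := h2
    obtain ⟨i, hi, rfl⟩ := exists_getVert_eq_of_mem_support hc hxc
    obtain ⟨j, hj, rfl⟩ := exists_getVert_eq_of_mem_support hc hyc
    exact hy ((hconst j hj.le).2 ((hconst i hi.le).1 hx))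
  have hne1 : changes (fun k => c.getVert k ∈ A) c.length ≠ 1 := fun h => by
    rw [h] at hodd
    exact hodd.1 odd_one (by simp)
  omega

/-- A non-interleaved cycle has no chord `xy` such that `G - {x, y}` is connected. -/
theorem mem_edges_of_adj {v x y : V} {c : G.Walk v v} (hc : c.IsCycle)
    (hni : ¬IsInterleaved c) (hconn : SetConn G ({x, y} : Set V)ᶜ) (hxy : G.Adj x y)
    (hx : x ∈ c.support) (hy : y ∈ c.support) : s(x, y) ∈ c.edges := by
  obtain ⟨i, hi, rfl⟩ := exists_getVert_eq_of_mem_support hc hx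
  obtain ⟨j, hj, rfl⟩ := exists_getVert_eq_of_mem_support hc hy
  wlog hij : i < j generalizing i j
  · rw [Sym2.eq_swap]
    refine this j hj hy i hi hx (by rwa [Set.pair_comm]) hxy.symm ?_
    have : i ≠ j := fun h => hxy.ne (by rw [h])
    omega
  by_contra hxe
  have hE : ∀ k < c.length, s(c.getVert k, c.getVert (k + 1)) ∈ c.edges := fun k hk =>
    (Walk.mk_mem_edges_iff_exists c).2 ⟨k, hk, rfl⟩
  have h3 := hc.three_le_length
  have h1 : i + 1 ≠ j := fun h => hxe (h ▸ hE i hi)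
  have h2 : ¬(i = 0 ∧ j + 1 = c.length) := by
    rintro ⟨rfl, h⟩
    have := hE j hj
    rw [h, Walk.getVert_length, Sym2.eq_swap] at this
    exact hxe (by simpa using this)
  have hmem : ∀ k < c.length, k ≠ i → k ≠ j →
      c.getVert k ∈ ({c.getVert i, c.getVert j} : Set V)ᶜ := by
    intro k hk hki hkj h
    rcases h with h | h
    · exact hki (eq_of_getVert_eq hc hk hi h)
    · exact hkj (eq_of_getVert_eq hc hk hj h)
  obtain ⟨t₀, ht₀, ht₀'⟩ : ∃ t < c.length, t < i ∨ j < t := by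
    by_cases h0 : i = 0
    · exact ⟨j + 1, by omega, by omega⟩
    · exact ⟨0, by omega, by omega⟩
  obtain ⟨s, t, hs, ht, ht', q, hq⟩ := exists_walk_between_arcs hc hconn hj (a := i)
    (fun h => h (Or.inl rfl)) (fun h => h (Or.inr rfl)) (s₀ := i + 1) (by omega)
    (hmem _ (by omega) (by omega) (by omega)) ht₀ ht₀' (hmem _ ht₀ (by omega) (by omega))
  have hadj : (G.deleteEdges c.edgeSet).Adj (c.getVert i) (c.getVert j) := by
    rw [deleteEdges_adj]
    exact ⟨hxy, fun h => hxe (Walk.mem_edgeSet.1 h)⟩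
  exact hni (isInterleaved_of_disjoint_walks (A := {c.getVert i, c.getVert j})
    disjoint_compl_right hj hs ht ht' hadj.toWalk (fun u hu => by
      simpa [Adj.toWalk] using hu) q hq)

/-! ### Weights of cuts -/

/-- The cycle form evaluates on a cut `δ(A)` to the number of times the cycle enters or leaves
`A`. -/
theorem edgeVector_dotProduct_cut [Fintype G.edgeSet] {v : V} {c : G.Walk v v} (hc : c.IsCycle)
    (A : Set V) : edgeVector G c.edgeSet ⬝ᵥ edgeVector G (cut G A) =
      changes (fun k => c.getVert k ∈ A) c.length := by
  classical
  have hE : ∀ k < c.length, s(c.getVert k, c.getVert (k + 1)) ∈ c.edges := fun k hk =>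
    (Walk.mk_mem_edges_iff_exists c).2 ⟨k, hk, rfl⟩
  have hcut : ∀ k < c.length, (s(c.getVert k, c.getVert (k + 1)) ∈ cut G A ↔
      ¬(c.getVert k ∈ A ↔ c.getVert (k + 1) ∈ A)) := by
    intro k hk
    constructor
    · rintro ⟨_, a, ha, b, hb, hab⟩
      rcases Sym2.eq_iff.1 hab with ⟨h1, h2⟩ | ⟨h1, h2⟩ <;> rw [h1, h2] <;> tauto
    · intro h
      refine ⟨c.edges_subset_edgeSet (hE k hk), ?_⟩
      by_cases hA : c.getVert k ∈ A
      · exact ⟨_, hA, _, by tauto, rfl⟩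
      · exact ⟨c.getVert (k + 1), by tauto, c.getVert k, hA, Sym2.eq_swap⟩
  have h1 : edgeVector G c.edgeSet ⬝ᵥ edgeVector G (cut G A) =
      #{e : G.edgeSet | (e : Sym2 V) ∈ c.edges ∧ (e : Sym2 V) ∈ cut G A} := by
    simp [edgeVector, dotProduct, Set.indicator_apply, Walk.mem_edgeSet, ← ite_and,
      Finset.sum_boole, and_comm]
  rw [h1, changes, Nat.cast_inj]
  symm
  refine Finset.card_bij (fun k hk => ⟨s(c.getVert k, c.getVert (k + 1)),
    c.edges_subset_edgeSet (hE k (mem_range.1 (mem_filter.1 hk).1))⟩) ?_ ?_ ?_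
  · intro k hk
    obtain ⟨hk, h⟩ := mem_filter.1 hk
    exact mem_filter.2 ⟨mem_univ _, hE k (mem_range.1 hk), (hcut k (mem_range.1 hk)).2 h⟩
  · intro k hk l hl hkl
    have hk' := mem_range.1 (mem_filter.1 hk).1
    have hl' := mem_range.1 (mem_filter.1 hl).1
    have hnd := hc.isTrail.edges_nodup
    rw [← Walk.length_edges] at hk' hl'
    refine (hnd.getElem_inj_iff (hi := hk') (hj := hl')).1 ?_
    rw [Walk.getElem_edges, Walk.getElem_edges]
    exact congrArg Subtype.val hkl
  · rintro ⟨e, he⟩ h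
    induction e with
    | _ x y =>
    obtain ⟨_, h1, h2⟩ := mem_filter.1 h
    obtain ⟨k, hk, hke⟩ := (Walk.mk_mem_edges_iff_exists c).1 h1
    refine ⟨k, mem_filter.2 ⟨mem_range.2 hk, (hcut k hk).1 (hke ▸ h2)⟩, Subtype.ext hke⟩

open Classical in
/-- The entry of `y` at the edge `uv`, and `0` if `u` and `v` are not adjacent. -/
noncomputable def weight (y : G.edgeSet → ℝ) (u v : V) : ℝ :=
  if h : G.Adj u v then y ⟨s(u, v), h⟩ else 0

/-- The total `y`-weight of the edges between `A` and `B`, which are meant to be disjoint: an edge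
with both ends in `A ∩ B` counts twice. -/
noncomputable def weightBetween (y : G.edgeSet → ℝ) (A B : Finset V) : ℝ :=
  ∑ u ∈ A, ∑ v ∈ B, weight y u v

theorem weight_of_adj (y : G.edgeSet → ℝ) {u v : V} (h : G.Adj u v) :
    weight y u v = y ⟨s(u, v), h⟩ := dif_pos h

theorem weight_of_not_adj (y : G.edgeSet → ℝ) {u v : V} (h : ¬G.Adj u v) :
    weight y u v = 0 := dif_neg h

theorem weight_comm (y : G.edgeSet → ℝ) (u v : V) : weight y u v = weight y v u := by
  unfold weight
  by_cases h : G.Adj u v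
  · rw [dif_pos h, dif_pos h.symm]
    congr 1
    exact Subtype.ext Sym2.eq_swap
  · rw [dif_neg h, dif_neg fun h' => h h'.symm]

theorem weightBetween_comm (y : G.edgeSet → ℝ) (A B : Finset V) :
    weightBetween y A B = weightBetween y B A := by
  unfold weightBetween
  rw [Finset.sum_comm]
  simp_rw [weight_comm y]

theorem weightBetween_union_right [DecidableEq V] (y : G.edgeSet → ℝ) (A : Finset V)
    {B C : Finset V} (h : Disjoint B C) :
    weightBetween y A (B ∪ C) = weightBetween y A B + weightBetween y A C := by
  simp only [weightBetween, Finset.sum_union h, Finset.sum_add_distrib]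

theorem weightBetween_union_left [DecidableEq V] (y : G.edgeSet → ℝ) {A B : Finset V}
    (C : Finset V) (h : Disjoint A B) :
    weightBetween y (A ∪ B) C = weightBetween y A C + weightBetween y B C := by
  simp only [weightBetween, Finset.sum_union h]

theorem weightBetween_singleton (y : G.edgeSet → ℝ) (u v : V) :
    weightBetween y {u} {v} = weight y u v := by simp [weightBetween]

theorem exists_adj_of_weightBetween_ne_zero {y : G.edgeSet → ℝ} {A B : Finset V}
    (h : weightBetween y A B ≠ 0) : ∃ a ∈ A, ∃ b ∈ B, G.Adj a b := by
  by_contra! hcon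
  exact h (Finset.sum_eq_zero fun a ha => Finset.sum_eq_zero fun b hb =>
    weight_of_not_adj y (hcon a ha b hb))

theorem dotProduct_edgeVector_cut [Fintype V] [DecidableEq V] [Fintype G.edgeSet]
    (y : G.edgeSet → ℝ) (A : Finset V) :
    y ⬝ᵥ edgeVector G (cut G A) = weightBetween y A Aᶜ := by
  classical
  have h1 : y ⬝ᵥ edgeVector G (cut G A) =
      ∑ e ∈ univ.filter (fun e : G.edgeSet => (e : Sym2 V) ∈ cut G A), y e := by
    simp [edgeVector, dotProduct, Set.indicator_apply, Finset.sum_filter]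
  have h2 : weightBetween y A Aᶜ =
      ∑ p ∈ (A ×ˢ Aᶜ).filter (fun p => G.Adj p.1 p.2), weight y p.1 p.2 := by
    rw [weightBetween, ← Finset.sum_product', Finset.sum_filter]
    refine Finset.sum_congr rfl fun p _ => ?_
    split_ifs with h
    · rfl
    · exact weight_of_not_adj y h
  rw [h1, h2]
  symm
  refine Finset.sum_bij (fun p hp => ⟨s(p.1, p.2), (mem_filter.1 hp).2⟩) ?_ ?_ ?_ ?_
  · rintro ⟨a, b⟩ hp
    obtain ⟨hp, hab⟩ := mem_filter.1 hp
    obtain ⟨ha, hb⟩ := mem_product.1 hp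
    exact mem_filter.2 ⟨mem_univ _, hab, a, ha, b, by simpa using hb, rfl⟩
  · rintro ⟨a, b⟩ hp ⟨a', b'⟩ hp' h
    obtain ⟨ha, hb⟩ := mem_product.1 (mem_filter.1 hp).1
    obtain ⟨ha', hb'⟩ := mem_product.1 (mem_filter.1 hp').1
    rcases Sym2.eq_iff.1 (congrArg Subtype.val h) with ⟨h1, h2⟩ | ⟨h1, h2⟩
    · exact Prod.ext h1 h2
    · exact absurd ha (by simp only at h1; rw [h1]; simpa using hb')
  · rintro ⟨e, he⟩ h
    obtain ⟨hadj, a, ha, b, hb, rfl⟩ := (mem_filter.1 h).2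
    exact ⟨(a, b), mem_filter.2 ⟨mem_product.2 ⟨ha, by simpa using hb⟩, hadj⟩, rfl⟩
  · rintro ⟨a, b⟩ hp
    exact weight_of_adj y (mem_filter.1 hp).2

/-! ### Weights that are constant on the bonds meeting the cycle -/

/-- All bonds `δ(A)` such that `A` and its complement both meet the cycle `c` have the same
`y`-weight `β`. -/
def ConstOnBonds [Fintype V] [DecidableEq V] {v : V} (c : G.Walk v v) (y : G.edgeSet → ℝ)
    (β : ℝ) : Prop :=
  ∀ A : Finset V, SetConn G A → SetConn G (A : Set V)ᶜ → (∃ x ∈ A, x ∈ c.support) →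
    (∃ x ∉ A, x ∈ c.support) → weightBetween y A Aᶜ = β

theorem constOnBonds_edgeVector [Fintype V] [DecidableEq V] [Fintype G.edgeSet] {v : V}
    {c : G.Walk v v} (hc : c.IsCycle) (hni : ¬IsInterleaved c) :
    ConstOnBonds c (edgeVector G c.edgeSet) 2 := by
  intro A hA hA' h1 h2
  rw [← dotProduct_edgeVector_cut, edgeVector_dotProduct_cut hc, changes_eq_two hc hni hA hA' h1 h2]
  norm_num

theorem weightBetween_edgeVector_eq_zero {v : V} {c : G.Walk v v} {S A : Finset V}
    (hS : ∀ x ∈ S, x ∉ c.support) : weightBetween (edgeVector G c.edgeSet) S A = 0 := by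
  refine Finset.sum_eq_zero fun a ha => Finset.sum_eq_zero fun b hb => ?_
  by_cases h : G.Adj a b
  · rw [weight_of_adj _ h, edgeVector, Set.indicator_of_notMem]
    exact fun he => hS a ha (c.fst_mem_support_of_mem_edges (Walk.mem_edgeSet.1 he))
  · exact weight_of_not_adj _ h

section Four

variable {v : V} {c : G.Walk v v}

/-- A partition of the nodes of `G` into four connected sets `S`, `A`, `B`, `D`, of which `S`
avoids the cycle `c` and is adjacent to the others, while `A`, `B` and `D` meet `c`. -/
structure IsCyclePartition (c : G.Walk v v) (S A B D : Finset V) : Prop where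
  cover : ∀ x, x ∈ S ∨ x ∈ A ∨ x ∈ B ∨ x ∈ D
  disjSA : Disjoint S A
  disjSB : Disjoint S B
  disjSD : Disjoint S D
  disjAB : Disjoint A B
  disjAD : Disjoint A D
  disjBD : Disjoint B D
  connS : SetConn G S
  connA : SetConn G A
  connB : SetConn G B
  connD : SetConn G D
  adjA : ∃ a ∈ S, ∃ b ∈ A, G.Adj a b
  adjB : ∃ a ∈ S, ∃ b ∈ B, G.Adj a b
  adjD : ∃ a ∈ S, ∃ b ∈ D, G.Adj a b
  avoidS : ∀ x ∈ S, x ∉ c.support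
  meetA : ∃ x ∈ A, x ∈ c.support
  meetB : ∃ x ∈ B, x ∈ c.support
  meetD : ∃ x ∈ D, x ∈ c.support

namespace IsCyclePartition

variable {S A B D : Finset V}

theorem rotate (h : IsCyclePartition c S A B D) : IsCyclePartition c S B D A :=
  { cover := fun x => by have := h.cover x; tauto
    disjSA := h.disjSB
    disjSB := h.disjSD
    disjSD := h.disjSA
    disjAB := h.disjBD
    disjAD := h.disjAB.symm
    disjBD := h.disjAD.symm
    connS := h.connS
    connA := h.connB
    connB := h.connD
    connD := h.connA
    adjA := h.adjB
    adjB := h.adjD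
    adjD := h.adjA
    avoidS := h.avoidS
    meetA := h.meetB
    meetB := h.meetD
    meetD := h.meetA }

variable [Fintype V] [DecidableEq V]

theorem compl_left (h : IsCyclePartition c S A B D) : Aᶜ = S ∪ B ∪ D := by
  ext x
  have h1 := h.cover x
  have h2 : x ∈ S → x ∉ A := fun h' => Finset.disjoint_left.1 h.disjSA h'
  have h3 : x ∈ A → x ∉ B := fun h' => Finset.disjoint_left.1 h.disjAB h'
  have h4 : x ∈ A → x ∉ D := fun h' => Finset.disjoint_left.1 h.disjAD h'
  simp only [mem_compl, mem_union]
  tauto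

theorem compl_union (h : IsCyclePartition c S A B D) : (S ∪ A)ᶜ = B ∪ D := by
  rw [Finset.compl_union, h.compl_left]
  ext x
  have h2 : x ∈ S → x ∉ B := fun h' => Finset.disjoint_left.1 h.disjSB h'
  have h3 : x ∈ S → x ∉ D := fun h' => Finset.disjoint_left.1 h.disjSD h'
  simp only [mem_compl, mem_union, mem_inter]
  tauto

theorem weight_left (h : IsCyclePartition c S A B D) {y : G.edgeSet → ℝ} {β : ℝ}
    (hy : ConstOnBonds c y β) :
    weightBetween y S A + weightBetween y A B + weightBetween y A D = β := by
  have hAc := h.compl_left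
  obtain ⟨x, hx, hxc⟩ := h.meetB
  rw [← hy A h.connA ?_ h.meetA ⟨x, Finset.disjoint_right.1 h.disjAB hx, hxc⟩, hAc,
    weightBetween_union_right _ _ (Finset.disjoint_union_left.2 ⟨h.disjSD, h.disjBD⟩),
    weightBetween_union_right _ _ h.disjSB, weightBetween_comm y A S]
  rw [← Finset.coe_compl, hAc, Finset.coe_union, Finset.coe_union]
  obtain ⟨s, hs, d, hd, hsd⟩ := h.adjD
  exact (h.connS.union h.connB h.adjB).union h.connD ⟨s, Or.inl hs, d, hd, hsd⟩

theorem weight_union (h : IsCyclePartition c S A B D) {y : G.edgeSet → ℝ} {β : ℝ}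
    (hy : ConstOnBonds c y β) (hBD : ∃ a ∈ B, ∃ b ∈ D, G.Adj a b) :
    weightBetween y S B + weightBetween y S D + weightBetween y A B + weightBetween y A D = β := by
  have hc := h.compl_union
  obtain ⟨x, hx, hxc⟩ := h.meetA
  obtain ⟨z, hz, hzc⟩ := h.meetB
  rw [← hy (S ∪ A) ?_ ?_ ⟨x, Finset.mem_union_right _ hx, hxc⟩ ⟨z, ?_, hzc⟩, hc,
    weightBetween_union_right _ _ h.disjBD, weightBetween_union_left _ _ h.disjSA,
    weightBetween_union_left _ _ h.disjSA]
  · ring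
  · rw [Finset.coe_union]
    exact h.connS.union h.connA h.adjA
  · rw [← Finset.coe_compl, hc, Finset.coe_union]
    exact h.connB.union h.connD hBD
  · rw [← Finset.mem_compl, hc]
    exact Finset.mem_union_left _ hz

/-- In a cycle partition for a non-interleaved cycle, the sets meeting the cycle are pairwise
adjacent: each of them is left by exactly two edges of the cycle, so the cycle has exactly one edge
between any two of them. -/
theorem adj [Fintype G.edgeSet] (h : IsCyclePartition c S A B D) (hc : c.IsCycle)
    (hni : ¬IsInterleaved c) :
    ∃ a ∈ B, ∃ b ∈ D, G.Adj a b := by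
  have hy := constOnBonds_edgeVector hc hni
  have h1 := h.weight_left hy
  have h2 := h.rotate.weight_left hy
  have h3 := h.rotate.rotate.weight_left hy
  simp only [weightBetween_edgeVector_eq_zero h.avoidS, weightBetween_comm _ D,
    weightBetween_comm _ B A] at h1 h2 h3
  refine exists_adj_of_weightBetween_ne_zero (y := edgeVector G c.edgeSet) ?_
  intro h0
  linarith

/-- In a cycle partition, the bonds of `A`, `B`, `D` and of their unions with `S` force the weight
between `S` and each of the other sets to vanish. -/
theorem weight_eq_zero [Fintype G.edgeSet] (h : IsCyclePartition c S A B D) (hc : c.IsCycle)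
    (hni : ¬IsInterleaved c) {y : G.edgeSet → ℝ} {β : ℝ} (hy : ConstOnBonds c y β) :
    weightBetween y S A = 0 ∧ weightBetween y S B = 0 ∧ weightBetween y S D = 0 := by
  have key : ∀ {A B D : Finset V}, IsCyclePartition c S A B D →
      weightBetween y S A = weightBetween y S B + weightBetween y S D := by
    intro A B D h
    have h1 := h.weight_left hy
    have h2 := h.weight_union hy (h.adj hc hni)
    linarith
  have h1 := key h
  have h2 := key h.rotate
  have h3 := key h.rotate.rotate
  refine ⟨?_, ?_, ?_⟩ <;> linarith

end IsCyclePartition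

end Four

/-! ### Cycle partitions of 3-connected graphs -/

theorem IsKConnected.setConn_compl [Finite V] {k : ℕ} (hG : IsKConnected G k) {Z : Finset V}
    (hZ : Z.card < k) : SetConn G (Z : Set V)ᶜ := by
  rintro T ⟨a, haT, haZ⟩ hcl b hb
  by_cases hab : a = b
  · exact hab ▸ haT
  obtain ⟨P, -, hP⟩ := hG.2 a b hab
  -- One of the `k` paths avoids `Z`, since a node of `Z` is on at most one of them.
  obtain ⟨i, hi⟩ : ∃ i, ∀ u ∈ (P i : G.Walk a b).support, u ∉ Z := by
    by_contra! hcon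
    choose z hz hzZ using hcon
    have hinj : Function.Injective z := by
      intro i j hij
      by_contra hne
      rcases hP i j hne (z i) (hz i) (hij ▸ hz j) with h | h
      · exact haZ (h ▸ hzZ i)
      · exact hb (h ▸ hzZ i)
    have := Finset.card_le_card_of_injOn (s := univ) (t := Z) z (fun i _ => hzZ i)
      hinj.injOn
    rw [Finset.card_univ, Fintype.card_fin] at this
    omega
  have key : ∀ (x y : V) (p : G.Walk x y), (∀ u ∈ p.support, u ∉ Z) → x ∈ T → y ∈ T := by
    intro x y p
    induction p with
    | nil => exact fun _ => id
    | @cons x w y hxw p ih =>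
      intro h hx
      rw [Walk.support_cons] at h
      exact ih (fun u hu => h u (List.mem_cons_of_mem _ hu))
        (hcl x ⟨hx, h x List.mem_cons_self⟩ w
          (h w (List.mem_cons_of_mem _ p.start_mem_support)) hxw)
  exact key a b (P i) hi haT

theorem exists_mem_support_notMem {v : V} {c : G.Walk v v} (hc : c.IsCycle) {Z : Finset V}
    (hZ : Z.card < 3) : ∃ x ∈ c.support, x ∉ Z := by
  by_contra! hcon
  have h3 := hc.three_le_length
  have := Finset.card_le_card_of_injOn (s := range c.length) (t := Z) c.getVert
    (fun i _ => hcon _ (Walk.getVert_mem_support _ _))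
    (fun i hi j hj h => eq_of_getVert_eq hc (by simpa using hi) (by simpa using hj) h)
  rw [card_range] at this
  omega

/-- In a 3-connected graph, let `S` be nonempty and off the cycle. If the nodes outside `S ∪ D`
induce a connected graph and `k ≤ 3 - |D|`, then they can be partitioned into `k` connected sets
that all meet the cycle and are adjacent to `S`: fewer than `k` nodes together with `D` do not
separate `S` from the cycle, so Menger's theorem applies. -/
theorem exists_partition_meeting_cycle [Fintype V] [DecidableEq V] (hG : IsKConnected G 3) {v : V}
    {c : G.Walk v v} (hc : c.IsCycle) {k : ℕ} [NeZero k] {S D : Finset V} (hS : S.Nonempty)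
    (hSc : ∀ x ∈ S, x ∉ c.support) (hSD : Disjoint S D) (hk : k + D.card ≤ 3)
    (hR : SetConn G ((S ∪ D : Finset V) : Set V)ᶜ) :
    ∃ W : Fin k → Finset V, (∀ i, SetConn G (W i)) ∧ (∀ i j, i ≠ j → Disjoint (W i) (W j)) ∧
      (∀ i, ∃ a ∈ S, ∃ b ∈ W i, G.Adj a b) ∧ (∀ i, ∃ x ∈ W i, x ∈ c.support) ∧
      ∀ x, (∃ i, x ∈ W i) ↔ x ∉ S ∪ D := by
  classical
  obtain ⟨W, h1, h2, h3, h4, h5⟩ := exists_disjoint_setConn_of_separators (G := G)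
    (R := ((S ∪ D : Finset V) : Set V)ᶜ)
    (N := {x | x ∉ S ∪ D ∧ ∃ a ∈ S, G.Adj a x}) (C := {x | x ∈ c.support}) (k := k)
    (fun x hx => by simpa using hx.1) (by
      intro U Z hU hZN hZU
      by_contra! hlt
      -- `S ∪ U` is closed in the graph without `D` and the separator, but misses the cycle.
      let Z' : Finset V := (Z.filter fun x => x ∉ S ∧ x ∉ U) ∪ D
      have hcard : Z'.card < 3 := by
        have h1 := Finset.card_union_le (Z.filter fun x => x ∉ S ∧ x ∉ U) D
        have h2 := Finset.card_filter_le Z fun x => x ∉ S ∧ x ∉ U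
        have h3 : Z'.card ≤ _ := h1
        omega
      have hUR : ∀ x ∈ U, x ∉ D ∧ x ∉ c.support := fun x hx => by
        have h := hU x hx
        simp only [Set.mem_compl_iff, mem_coe, mem_union, not_or] at h
        exact ⟨h.1.2, h.2⟩
      obtain ⟨x, hxc, hxZ⟩ := exists_mem_support_notMem hc hcard
      obtain ⟨s, hs⟩ := hS
      have hsub := hG.setConn_compl hcard {x | x ∈ S ∨ x ∈ U} ⟨s, Or.inl hs, by
        have := Finset.disjoint_left.1 hSD hs
        simp [Z', hs, this]⟩ (by
        rintro a ⟨ha, -⟩ b hbZ hab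
        by_contra hb
        simp only [Set.mem_ofPred_eq, not_or] at hb
        have hbD : b ∉ D := fun h => hbZ (by simp [Z', h])
        have hbR : b ∉ S ∪ D := by simp [hb.1, hbD]
        have hbZ1 : b ∈ Z := by
          rcases ha with ha | ha
          · exact hZN b ⟨hbR, a, ha, hab⟩ hb.2
          · exact hZU a ha b (by simpa using hbR) hab hb.2
        exact hbZ (by simp [Z', hbZ1, hb.1, hb.2]))
      rcases hsub (by simpa using hxZ) with h | h
      · exact hSc x h hxc
      · exact (hUR x h).2 hxc)
  obtain ⟨W', g1, g2, g3, g4⟩ := hR.exists_partition_extending W h1 h2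
    (fun i => (h3 i).mono Set.inter_subset_left) h5
  have hmem : ∀ i x, x ∈ (W' i).toFinset ↔ x ∈ W' i := fun i x => Set.mem_toFinset
  refine ⟨fun i => (W' i).toFinset, fun i => by simpa using g2 i, fun i j hij => ?_, fun i => ?_,
    fun i => ?_, fun x => ?_⟩
  · simpa using g3 i j hij
  · obtain ⟨x, hx, -, a, ha, hax⟩ := h3 i
    exact ⟨a, ha, x, (hmem i x).2 (g1 i hx), hax⟩
  · obtain ⟨x, hx, hxc⟩ := h4 i
    exact ⟨x, (hmem i x).2 (g1 i hx), hxc⟩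
  · have : x ∈ ⋃ i, W' i ↔ x ∈ ((S ∪ D : Finset V) : Set V)ᶜ := by rw [g4]
    simpa using this

theorem weightBetween_pair [Fintype V] [DecidableEq V] (y : G.edgeSet → ℝ) {a b : V} (hab : a ≠ b) :
    weightBetween y {a} {a}ᶜ + weightBetween y {b} {b}ᶜ =
      weightBetween y {a, b} {a, b}ᶜ + 2 * weight y a b := by
  have h0 : ({a, b} : Finset V) = {a} ∪ {b} := rfl
  have hd : Disjoint ({a} : Finset V) {b} := by simpa using hab
  have h1 : ({a} : Finset V)ᶜ = {a, b}ᶜ ∪ {b} := by ext x; simp; grind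
  have h2 : ({b} : Finset V)ᶜ = {a, b}ᶜ ∪ {a} := by ext x; simp; grind
  rw [h1, h2, weightBetween_union_right _ _ (by simp), weightBetween_union_right _ _ (by simp), h0,
    weightBetween_union_left _ _ hd, weightBetween_singleton, weightBetween_singleton,
    weight_comm y b a]
  ring

/-- For an edge `ab` of the cycle, the bonds `δ({a})`, `δ({b})` and `δ({a, b})` determine the weight
of `ab`. -/
theorem ConstOnBonds.weight_of_mem_edges [Fintype V] [DecidableEq V]
    (hG : IsKConnected G 3) {v : V} {c : G.Walk v v} (hc : c.IsCycle)
    {y : G.edgeSet → ℝ} {β : ℝ} (hy : ConstOnBonds c y β) {a b : V} (h : s(a, b) ∈ c.edges) :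
    weight y a b = β / 2 := by
  have hab : G.Adj a b := c.adj_of_mem_edges h
  have hbond : ∀ S : Finset V, SetConn G S → S.card < 3 → (∃ x ∈ S, x ∈ c.support) →
      weightBetween y S Sᶜ = β := fun S h1 h2 h3 => by
    obtain ⟨x, hx, hxS⟩ := exists_mem_support_notMem hc h2
    exact hy S h1 (hG.setConn_compl h2) h3 ⟨x, hxS, hx⟩
  have ha := c.fst_mem_support_of_mem_edges h
  have hb := c.snd_mem_support_of_mem_edges h
  have h1 := hbond {a} (by simpa using setConn_singleton a) (by simp) ⟨a, by simp, ha⟩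
  have h2 := hbond {b} (by simpa using setConn_singleton b) (by simp) ⟨b, by simp, hb⟩
  have h3 := hbond {a, b} (by
    rw [Finset.coe_insert, Finset.coe_singleton, Set.insert_eq]
    exact (setConn_singleton a).union (setConn_singleton b) ⟨a, rfl, b, rfl, hab⟩)
    (Finset.card_le_two.trans_lt (by norm_num)) ⟨a, by simp, ha⟩
  have := weightBetween_pair y hab.ne
  linarith

section Weights

variable [Fintype V] [DecidableEq V] [Fintype G.edgeSet] {v : V} {c : G.Walk v v}

/-- A bond `δ(S)` that avoids the cycle has weight zero, where `S` consists of one or two nodes off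
the cycle: `S` extends to a cycle partition. -/
theorem ConstOnBonds.weightBetween_compl_eq_zero (hG : IsKConnected G 3)
    (hc : c.IsCycle) (hni : ¬IsInterleaved c) {y : G.edgeSet → ℝ} {β : ℝ} (hy : ConstOnBonds c y β)
    {S : Finset V} (hS : S.Nonempty)
    (hSconn : SetConn G S) (hScard : S.card < 3) (hSc : ∀ x ∈ S, x ∉ c.support) :
    weightBetween y S Sᶜ = 0 := by
  obtain ⟨W, h1, h2, h3, h4, h5⟩ := exists_partition_meeting_cycle hG hc (k := 3) (D := ∅) hS hSc
    (by simp) (by simp) (by simpa using hG.setConn_compl hScard)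
  simp only [Finset.union_empty] at h5
  have hSW : ∀ i, Disjoint S (W i) := fun i =>
    Finset.disjoint_right.2 fun {x} hx => (h5 x).1 ⟨i, hx⟩
  have h01 := h2 0 1 (by decide)
  have h02 := h2 0 2 (by decide)
  have h12 := h2 1 2 (by decide)
  have hpart : IsCyclePartition c S (W 0) (W 1) (W 2) :=
    { cover := fun x => by
        have := h5 x
        rw [Fin.exists_fin_succ, Fin.exists_fin_two] at this
        change (x ∈ W 0 ∨ x ∈ W 1 ∨ x ∈ W 2) ↔ _ at this
        tauto
      disjSA := hSW 0
      disjSB := hSW 1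
      disjSD := hSW 2
      disjAB := h01
      disjAD := h02
      disjBD := h12
      connS := hSconn
      connA := h1 0
      connB := h1 1
      connD := h1 2
      adjA := h3 0
      adjB := h3 1
      adjD := h3 2
      avoidS := hSc
      meetA := h4 0
      meetB := h4 1
      meetD := h4 2 }
  obtain ⟨e1, e2, e3⟩ := hpart.weight_eq_zero hc hni hy
  have hcompl : Sᶜ = W 0 ∪ (W 1 ∪ W 2) := by
    ext x
    have := hpart.cover x
    have a0 : x ∈ S → x ∉ W 0 := fun h' => Finset.disjoint_left.1 (hSW 0) h'
    have a1 : x ∈ S → x ∉ W 1 := fun h' => Finset.disjoint_left.1 (hSW 1) h'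
    have a2 : x ∈ S → x ∉ W 2 := fun h' => Finset.disjoint_left.1 (hSW 2) h'
    simp only [mem_compl, mem_union]
    tauto
  rw [hcompl, weightBetween_union_right _ _ (Finset.disjoint_union_right.2 ⟨h01, h02⟩),
    weightBetween_union_right _ _ h12, e1, e2, e3]
  norm_num

theorem ConstOnBonds.weight_of_notMem_edges (hG : IsKConnected G 3) (hc : c.IsCycle)
    (hni : ¬IsInterleaved c) {y : G.edgeSet → ℝ} {β : ℝ} (hy : ConstOnBonds c y β) {a b : V}
    (hab : G.Adj a b) (h : s(a, b) ∉ c.edges) : weight y a b = 0 := by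
  wlog ha : a ∉ c.support generalizing a b
  · by_cases hb : b ∈ c.support
    · refine absurd (mem_edges_of_adj hc hni ?_ hab (not_not.1 ha) hb) h
      simpa using hG.setConn_compl (Z := {a, b}) (Finset.card_le_two.trans_lt (by norm_num))
    · rw [weight_comm]
      exact this hab.symm (by rwa [Sym2.eq_swap]) hb
  by_cases hb : b ∈ c.support
  · -- A cycle partition with the single node `a` off the cycle and `{b}` as one of its arcs.
    have hbc : ({a} ∪ {b} : Finset V).card < 3 := Finset.card_le_two.trans_lt (by norm_num)
    obtain ⟨W, h1, h2, h3, h4, h5⟩ := exists_partition_meeting_cycle hG hc (k := 2) (S := {a})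
      (D := {b}) (by simp) (by simpa using ha) (by simpa using hab.ne) (by simp)
      (hG.setConn_compl hbc)
    have h6 : ∀ i, ∀ x ∈ W i, x ≠ a ∧ x ≠ b := fun i x hx => by
      simpa using (h5 x).1 ⟨i, hx⟩
    have hpart : IsCyclePartition c {a} {b} (W 0) (W 1) :=
      { cover := fun x => by
          have := h5 x
          rw [Fin.exists_fin_two] at this
          simp only [mem_union, mem_singleton] at this ⊢
          tauto
        disjSA := by simpa using hab.ne
        disjSB := by simpa using fun hx => (h6 0 a hx).1 rfl
        disjSD := by simpa using fun hx => (h6 1 a hx).1 rfl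
        disjAB := by simpa using fun hx => (h6 0 b hx).2 rfl
        disjAD := by simpa using fun hx => (h6 1 b hx).2 rfl
        disjBD := h2 0 1 (by decide)
        connS := by simpa using setConn_singleton a
        connA := by simpa using setConn_singleton b
        connB := h1 0
        connD := h1 1
        adjA := ⟨a, by simp, b, by simp, hab⟩
        adjB := h3 0
        adjD := h3 1
        avoidS := by simpa using ha
        meetA := ⟨b, by simp, hb⟩
        meetB := h4 0
        meetD := h4 1 }
    rw [← weightBetween_singleton]
    exact (hpart.weight_eq_zero hc hni hy).1
  · -- The bonds `δ({a})`, `δ({b})` and `δ({a, b})` all avoid the cycle.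
    have h1 := hy.weightBetween_compl_eq_zero hG hc hni (S := {a}) (by simp)
      (by simpa using setConn_singleton a) (by simp) (by simpa using ha)
    have h2 := hy.weightBetween_compl_eq_zero hG hc hni (S := {b}) (by simp)
      (by simpa using setConn_singleton b) (by simp) (by simpa using hb)
    have h3 := hy.weightBetween_compl_eq_zero hG hc hni (S := {a, b}) (by simp) (by
      rw [Finset.coe_insert, Finset.coe_singleton, Set.insert_eq]
      exact (setConn_singleton a).union (setConn_singleton b) ⟨a, rfl, b, rfl, hab⟩)
      (Finset.card_le_two.trans_lt (by norm_num)) (by simp [ha, hb])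
    have := weightBetween_pair y hab.ne
    linarith

/-- A weight that is constant on the bonds meeting the cycle in two edges is a multiple of the
indicator vector of the cycle. -/
theorem ConstOnBonds.eq_smul (hG : IsKConnected G 3) (hc : c.IsCycle)
    (hni : ¬IsInterleaved c) {y : G.edgeSet → ℝ} {β : ℝ} (hy : ConstOnBonds c y β) :
    y = (β / 2) • edgeVector G c.edgeSet := by
  funext ⟨e, he⟩
  induction e with
  | _ a b =>
  have hab : G.Adj a b := he
  rw [← weight_of_adj y hab, Pi.smul_apply, edgeVector]
  by_cases h : s(a, b) ∈ c.edges
  · rw [hy.weight_of_mem_edges hG hc h, Set.indicator_of_mem]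
    · simp
    · exact Walk.mem_edgeSet.2 h
  · rw [hy.weight_of_notMem_edges hG hc hni hab h, Set.indicator_of_notMem]
    · simp
    · exact fun h' => h (Walk.mem_edgeSet.1 h')

end Weights

/-! ### Facets from uniqueness of the normal vector -/

theorem isValid_convexHull {ι : Type*} [Fintype ι] {X : Set (ι → ℝ)} {a : ι → ℝ} {b : ℝ}
    (h : ∀ x ∈ X, a ⬝ᵥ x ≤ b) : IsValid (convexHull ℝ X) a b := by
  intro x hx
  have hlin : IsLinearMap ℝ fun x : ι → ℝ => a ⬝ᵥ x :=
    ⟨fun x y => dotProduct_add a x y, fun r x => dotProduct_smul r a x⟩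
  exact convexHull_min (fun x hx => h x hx) (convex_halfSpace_le hlin b) hx

/-- A tight valid inequality with nonzero right-hand side of a set containing `0` defines a
facet if every linear form that is constant on its face is a multiple of its normal vector. -/
theorem isFacetDefining_of_forall_eq_smul {ι : Type*} [Fintype ι] {P : Set (ι → ℝ)} {a : ι → ℝ}
    {b : ℝ} (hb : b ≠ 0) (h0 : 0 ∈ P) (hval : IsValid P a b) (htight : (face P a b).Nonempty)
    (huniq : ∀ y : ι → ℝ, ∀ β : ℝ, (∀ x ∈ face P a b, y ⬝ᵥ x = β) → ∃ r : ℝ, y = r • a) :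
    IsFacetDefining P a b := by
  classical
  obtain ⟨x₀, hx₀⟩ := htight
  have ha : a ≠ 0 := by
    rintro rfl
    exact hb (by simpa using hx₀.2.symm)
  let φ : (ι → ℝ) →ₗ[ℝ] ℝ := dotProductEquiv ℝ ι a
  have hφ : ∀ x, φ x = a ⬝ᵥ x := fun x => rfl
  have hφ0 : φ ≠ 0 := fun h => hb (by rw [← hx₀.2, ← hφ, h]; rfl)
  have hker : vectorSpan ℝ (face P a b) = LinearMap.ker φ := by
    refine le_antisymm ?_ fun z hz => ?_
    · rw [vectorSpan_def, Submodule.span_le]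
      rintro _ ⟨x, hx, x', hx', rfl⟩
      change φ (x - x') = 0
      rw [map_sub, hφ, hφ, hx.2, hx'.2, sub_self]
    · by_contra hzF
      obtain ⟨f, hfz, hf⟩ := Submodule.exists_le_ker_of_notMem hzF
      obtain ⟨y, rfl⟩ := (dotProductEquiv ℝ ι).surjective f
      obtain ⟨r, rfl⟩ := huniq y (y ⬝ᵥ x₀) fun x hx => by
        have := hf (vsub_mem_vectorSpan ℝ hx hx₀)
        rw [LinearMap.mem_ker, vsub_eq_sub, map_sub, sub_eq_zero] at this
        exact this
      apply hfz
      rw [map_smul, LinearMap.smul_apply]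
      exact (congrArg (r • ·) (LinearMap.mem_ker.1 hz)).trans (smul_zero r)
  have htop : vectorSpan ℝ P = ⊤ := by
    rw [eq_top_iff]
    intro z _
    have hle : vectorSpan ℝ (face P a b) ≤ vectorSpan ℝ P :=
      vectorSpan_mono ℝ fun x hx => hx.1
    have hx₀P : x₀ ∈ vectorSpan ℝ P := by
      simpa using vsub_mem_vectorSpan ℝ hx₀.1 h0
    have hz : z - (φ z / b) • x₀ ∈ vectorSpan ℝ P := by
      refine hle ?_
      rw [hker, LinearMap.mem_ker, map_sub, map_smul, hφ x₀, hx₀.2, smul_eq_mul,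
        div_mul_cancel₀ _ hb, sub_self]
    simpa using add_mem hz (Submodule.smul_mem _ (φ z / b) hx₀P)
  refine ⟨hval, ha, ⟨x₀, hx₀⟩, ?_⟩
  rw [dim, dim, direction_affineSpan, direction_affineSpan, hker, htop, finrank_top]
  exact Module.Dual.finrank_ker_add_one_of_ne_zero hφ0

theorem edgeVector_cut_mem_bondPolytope {A : Set V} (h : SetConn G A) (h' : SetConn G Aᶜ) :
    edgeVector G (cut G A) ∈ bondPolytope G :=
  subset_convexHull ℝ _ ⟨cut G A, ⟨A, setConn_iff_preconnected.1 h, setConn_iff_preconnected.1 h',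
    rfl⟩, rfl⟩

end BondPolytope

theorem mainTheorem4 {V : Type*} [Finite V] (G : SimpleGraph V) [Fintype G.edgeSet]
    (hG : BondPolytope.IsKConnected G 3) {v : V} (c : G.Walk v v) (hc : c.IsCycle)
    (hni : ¬ BondPolytope.IsInterleaved c) :
    BondPolytope.IsFacetDefining (BondPolytope.bondPolytope G)
      (BondPolytope.edgeVector G c.edgeSet) 2 := by
  classical
  have := Fintype.ofFinite V
  have htight : ∀ A : Set V, BondPolytope.SetConn G A → BondPolytope.SetConn G Aᶜ →
      (∃ x ∈ A, x ∈ c.support) → (∃ x ∉ A, x ∈ c.support) →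
      BondPolytope.edgeVector G (BondPolytope.cut G A) ∈
        BondPolytope.face (BondPolytope.bondPolytope G) (BondPolytope.edgeVector G c.edgeSet) 2 :=
    fun A h1 h2 h3 h4 => ⟨BondPolytope.edgeVector_cut_mem_bondPolytope h1 h2, by
      rw [BondPolytope.edgeVector_dotProduct_cut hc,
        BondPolytope.changes_eq_two hc hni h1 h2 h3 h4]
      norm_num⟩
  refine BondPolytope.isFacetDefining_of_forall_eq_smul two_ne_zero ?_ ?_ ?_ ?_
  · -- The zero vector belongs to the empty bond `δ(∅)`.
    have h := BondPolytope.edgeVector_cut_mem_bondPolytope (G := G) BondPolytope.setConn_empty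
      (by simpa using hG.setConn_compl (Z := ∅) (by simp))
    convert h using 1
    funext e
    simp [BondPolytope.edgeVector, BondPolytope.cut]
  · refine BondPolytope.isValid_convexHull ?_
    rintro _ ⟨_, ⟨A, h1, h2, rfl⟩, rfl⟩
    rw [BondPolytope.edgeVector_dotProduct_cut hc]
    exact_mod_cast BondPolytope.changes_le_two hc hni
      (BondPolytope.setConn_iff_preconnected.2 h1) (BondPolytope.setConn_iff_preconnected.2 h2)
  · obtain ⟨x, hx, hxv⟩ := BondPolytope.exists_mem_support_notMem hc (Z := {v}) (by simp)
    exact ⟨_, htight {v} (BondPolytope.setConn_singleton v)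
      (by simpa using hG.setConn_compl (Z := {v}) (by simp)) ⟨v, rfl, c.start_mem_support⟩
      ⟨x, by simpa using hxv, hx⟩⟩
  · intro y β hy
    have hconst : BondPolytope.ConstOnBonds c y β := fun A h1 h2 h3 h4 => by
      rw [← BondPolytope.dotProduct_edgeVector_cut]
      exact hy _ (htight A h1 h2 h3 h4)
    exact ⟨_, hconst.eq_smul hG hc hni⟩
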